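/- Consider the original camel-banana problem. A camel moves along a line; the border of the desert is at position $0$, and positions are measured in miles into the desert. The camel can carry at most one banana at a time, and its stomach has room for one banana. Walking one mile, in either direction, uses one banana of its stomach contents. It eats only whole bananas, each at the position where the camel is (lying there or being carried), and therefore only when its stomach is empty. It may pick up a banana at its position and may put down the banana it carries at any position. For real $N \ge 0$, starting with $N$ bananas means: the camel is at position $0$ with $\lfloor N\rfloor$ bananas next to it and $N-\lfloor N\rfloor$ banana units in its stomach (for integer $N$: $N$ bananas and an empty stomach). The camel need not return. Let $p_2:\mathbb{R}\to(0,\infty)$ be the increasing bijection $$p_2(x) = 2^{\lfloor x\rfloor}\,\bigl(1 + x - \lfloor x\rfloor\bigr),$$ i.e. the function with $p_2(n)=2^n$ for $n\in\mathbb{Z}$ that is linear between consecutive integers, and let $p_2^{-1}$ be its inverse. Theorem. For every real $N\ge 3$, with $N$ bananas the camel cannot penetrate farther than $$\tfrac12\, p_2^{-1}\bigl(\tfrac23 (N-1)\bigr) + \tfrac{13}{6}$$ miles into the desert. -/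

import Mathlib

namespace CamelBanana

/-- The function `p_B` on the reals: it takes the value `(1 + 2/B)^n` at every integer `n` and is
linear between consecutive integers. -/
noncomputable def p (B : ℕ) (x : ℝ) : ℝ :=
  (1 + 2 / (B : ℝ)) ^ ⌊x⌋ * (1 + 2 / (B : ℝ) * (x - (⌊x⌋ : ℝ)))

/-- The inverse of `p_B`. For `1 ≤ B` the function `p_B` is a bijection from the reals onto the
positive reals, see `p_bijOn`, so at positive arguments this is the true inverse. -/
noncomputable def pInv (B : ℕ) : ℝ → ℝ := Function.invFun (p B)

theorem p_bijOn {B : ℕ} (hB : 1 ≤ B) : Set.BijOn (p B) Set.univ (Set.Ioi 0) := by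
  have hB' : (0 : ℝ) < 2 / (B : ℝ) := by
    have : (0 : ℝ) < (B : ℝ) := by exact_mod_cast hB
    positivity
  have key : ∀ x : ℝ, (1 + 2 / (B : ℝ)) ^ ⌊x⌋ ≤ p B x ∧
      p B x < (1 + 2 / (B : ℝ)) ^ (⌊x⌋ + 1) := by
    intro x
    have ha : (0 : ℝ) < (1 + 2 / (B : ℝ)) ^ ⌊x⌋ := by positivity
    have h0 := Int.floor_le x
    have h1 := Int.lt_floor_add_one x
    unfold p
    rw [zpow_add_one₀ (by positivity)]
    constructor
    · apply le_mul_of_one_le_right ha.le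
      nlinarith
    · apply mul_lt_mul_of_pos_left _ ha
      nlinarith
  refine ⟨fun x _ => ?_, fun x _ y _ h => ?_, fun y hy => ?_⟩
  · exact lt_of_lt_of_le (by positivity) (key x).1
  · have hk : ⌊x⌋ = ⌊y⌋ := by
      have hx := key x
      have hy := key y
      have hlt : (1 : ℝ) < 1 + 2 / (B : ℝ) := by linarith
      have h1 := (zpow_lt_zpow_iff_right₀ hlt).1 (lt_of_le_of_lt (h ▸ hx.1) hy.2)
      have h2 := (zpow_lt_zpow_iff_right₀ hlt).1 (lt_of_le_of_lt hy.1 (h ▸ hx.2))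
      omega
    have ha : (0 : ℝ) < (1 + 2 / (B : ℝ)) ^ ⌊y⌋ := by positivity
    unfold p at h
    rw [hk] at h
    have h2 := mul_left_cancel₀ ha.ne' h
    have h3 := mul_left_cancel₀ hB'.ne' (add_left_cancel h2)
    linarith
  · obtain ⟨n, hn1, hn2⟩ := exists_mem_Ico_zpow (Set.mem_Ioi.1 hy)
      (show (1 : ℝ) < 1 + 2 / (B : ℝ) by linarith)
    have ha : (0 : ℝ) < (1 + 2 / (B : ℝ)) ^ n := by positivity
    rw [zpow_add_one₀ (by positivity)] at hn2
    set a := (1 + 2 / (B : ℝ)) ^ n with hadef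
    have hq1 : 1 ≤ y / a := by rw [le_div_iff₀ ha]; linarith
    have hq2 : y / a < 1 + 2 / (B : ℝ) := by rw [div_lt_iff₀ ha]; linarith
    have hf : ⌊(n : ℝ) + (y / a - 1) / (2 / (B : ℝ))⌋ = n := by
      rw [Int.floor_eq_iff]
      constructor
      · have : 0 ≤ (y / a - 1) / (2 / (B : ℝ)) := div_nonneg (by linarith) hB'.le
        linarith
      · have : (y / a - 1) / (2 / (B : ℝ)) < 1 := by rw [div_lt_one hB']; linarith
        linarith
    refine ⟨(n : ℝ) + (y / a - 1) / (2 / (B : ℝ)), trivial, ?_⟩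
    unfold p
    rw [hf, ← hadef, add_sub_cancel_left, mul_div_cancel₀ _ hB'.ne']
    field_simp
    ring

theorem p_pInv {B : ℕ} (hB : 1 ≤ B) {y : ℝ} (hy : 0 < y) : p B (pInv B y) = y := by
  obtain ⟨x, -, hx⟩ := (p_bijOn hB).surjOn (Set.mem_Ioi.2 hy)
  exact Function.invFun_eq ⟨x, hx⟩

theorem pInv_p {B : ℕ} (hB : 1 ≤ B) (x : ℝ) : pInv B (p B x) = x :=
  Function.leftInverse_invFun (Set.injOn_univ.1 (p_bijOn hB).injOn) x

/-- A configuration of the original camel-banana problem: the position of the camel, the amount of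
banana in its stomach, whether it carries a banana (it carries at most one), and the positions
(with multiplicity) of the uneaten bananas that lie on the ground. -/
structure State where
  pos : ℝ
  stomach : ℝ
  carrying : Bool
  ground : Multiset ℝ

/-- The elementary actions of the camel. Walking uses one banana of stomach contents per mile.
Only whole bananas are eaten, and the stomach has room for one banana, so that a banana
can be eaten only on an empty stomach. -/
inductive Step : State → State → Prop
  /-- The camel walks straight from `x` to `y`, together with what it carries. -/
  | walk (x y s : ℝ) (b : Bool) (g : Multiset ℝ) (h : |y - x| ≤ s) :
      Step ⟨x, s, b, g⟩ ⟨y, s - |y - x|, b, g⟩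
  /-- The camel, carrying nothing, picks up a banana that lies at its position. -/
  | pickUp (x s : ℝ) (g : Multiset ℝ) :
      Step ⟨x, s, false, x ::ₘ g⟩ ⟨x, s, true, g⟩
  /-- The camel puts down the banana that it carries. -/
  | putDown (x s : ℝ) (g : Multiset ℝ) :
      Step ⟨x, s, true, g⟩ ⟨x, s, false, x ::ₘ g⟩
  /-- The camel eats a banana that lies at its position. -/
  | eatGround (x : ℝ) (b : Bool) (g : Multiset ℝ) :
      Step ⟨x, 0, b, x ::ₘ g⟩ ⟨x, 1, b, g⟩
  /-- The camel eats the banana that it carries. -/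
  | eatCarried (x : ℝ) (g : Multiset ℝ) :
      Step ⟨x, 0, true, g⟩ ⟨x, 1, false, g⟩

/-- The start with `N` bananas, `N` a nonnegative real: the camel is at the border of the desert
(position `0`) with `⌊N⌋` bananas next to it and `N - ⌊N⌋` banana units in its stomach. -/
noncomputable def start (N : ℝ) : State :=
  ⟨0, N - (⌊N⌋₊ : ℝ), false, Multiset.replicate ⌊N⌋₊ 0⟩

/-- With `N` bananas, the camel can reach the point `c` miles into the desert (one way trip):
some finite sequence of actions brings it there. -/
def CanPenetrate (N c : ℝ) : Prop :=
  ∃ t : State, Relation.ReflTransGen Step (start N) t ∧ t.pos = c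

end CamelBanana

namespace CamelBanana

/-! Give a banana at `x` the value `value x`, a convex function that doubles with every half mile,
and follow the trip backwards. Let the camel be at `q` with stomach contents `s`, and let `r` be the
place of its next meal. Until then no banana can be carried beyond `m = (q + r + s) / 2`, the
turning point of a walk of length `s` from `q` to `r`. The potential is the total value of the
bananas plus `value m - value q - value r`. Walking does not increase it (`value_walk`, by
monotonicity and convexity), and neither does eating (`value_full_stomach`, by convexity and
doubling).

The last two bananas are treated directly: both must get to `c - 2` or farther, and if one full
stomach suffices for that, their values add up to at least `3 / 2 * value (c - 13 / 6)`
(`value_pair`). At the start the potential is at most `N - 1` (`value_start`); inverting `p 2` gives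
the bound. -/

/-- The value of a banana at position `x`. -/
noncomputable def value (x : ℝ) : ℝ := p 2 (2 * x)

/-! ### Convexity and doubling of the value function. -/

theorem p_two (x : ℝ) : p 2 x = 2 ^ ⌊x⌋ * (1 + (x - ⌊x⌋)) := by
  unfold p
  norm_num

theorem p_two_add_one (x : ℝ) : p 2 (x + 1) = 2 * p 2 x := by
  rw [p_two, p_two, Int.floor_add_one, zpow_add_one₀ two_ne_zero]
  push_cast
  ring

/-- The lines that extend the linear pieces of `p 2` are support lines. -/
theorem p_two_support (x y : ℝ) : p 2 x + 2 ^ ⌊x⌋ * (y - x) ≤ p 2 y := by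
  have ha : (0 : ℝ) < 2 ^ ⌊x⌋ := by positivity
  have h0 := Int.floor_le y
  have h1 := Int.lt_floor_add_one y
  -- This is the claim divided by `2 ^ ⌊x⌋`. To the right of `⌊x⌋` it is Bernoulli's inequality; two
  -- or more pieces to the left the support line is already negative.
  have key : 1 + (y - ⌊x⌋) ≤ 2 ^ (⌊y⌋ - ⌊x⌋) * (1 + (y - ⌊y⌋)) := by
    rcases le_total ⌊x⌋ ⌊y⌋ with h | h
    · obtain ⟨k, hk⟩ := Int.eq_ofNat_of_zero_le (sub_nonneg.2 h)
      have hk' : (⌊y⌋ : ℝ) = ⌊x⌋ + k := by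
        have : ⌊y⌋ = ⌊x⌋ + k := by omega
        exact_mod_cast this
      rw [hk, zpow_natCast]
      have hb : (1 : ℝ) + k ≤ 2 ^ k := by
        have := one_add_mul_le_pow (show (-2 : ℝ) ≤ 1 by norm_num) k
        norm_num at this
        linarith
      have hk0 : (0 : ℝ) ≤ k := k.cast_nonneg
      nlinarith
    · have hz : (0 : ℝ) < 2 ^ (⌊y⌋ - ⌊x⌋) := by positivity
      rcases h.eq_or_lt with h | h
      · simp [h]
      · rcases (show ⌊x⌋ = ⌊y⌋ + 1 ∨ ⌊y⌋ + 2 ≤ ⌊x⌋ by omega) with h | h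
        · have h2 : (2 : ℝ) ^ (⌊y⌋ - (⌊y⌋ + 1)) = 1 / 2 := by norm_num
          rw [h, h2]
          push_cast
          linarith
        · have : (⌊y⌋ : ℝ) + 2 ≤ ⌊x⌋ := by exact_mod_cast h
          nlinarith
  have h2 := mul_le_mul_of_nonneg_left key ha.le
  rw [← mul_assoc, ← zpow_add₀ two_ne_zero, add_sub_cancel] at h2
  rw [p_two x, p_two y]
  linarith

theorem p_two_strictMono : StrictMono (p 2) := fun x y h => by
  have ha : (0 : ℝ) < 2 ^ ⌊x⌋ := by positivity
  have := p_two_support x y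
  nlinarith

theorem value_pos (x : ℝ) : 0 < value x := (p_bijOn one_le_two).mapsTo (Set.mem_univ _)

theorem value_mono : Monotone value := fun x y h =>
  p_two_strictMono.monotone (by linarith)

theorem value_add_half (x : ℝ) : value (x + 1 / 2) = 2 * value x := by
  rw [value, value, ← p_two_add_one]
  ring_nf

theorem convexOn_value : ConvexOn ℝ Set.univ value := by
  refine ⟨convex_univ, fun x _ y _ a b ha hb hab => ?_⟩
  simp only [smul_eq_mul, value]
  have hx := mul_le_mul_of_nonneg_left (p_two_support (2 * (a * x + b * y)) (2 * x)) ha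
  have hy := mul_le_mul_of_nonneg_left (p_two_support (2 * (a * x + b * y)) (2 * y)) hb
  obtain rfl : b = 1 - a := by linarith
  nlinarith

/-- Increments of a convex function over intervals of equal length grow to the right: both inner
points are convex combinations of `q - d` and `m`, with exchanged weights. -/
theorem value_add_le {q m d : ℝ} (hd : 0 ≤ d) (hm : q ≤ m) :
    value q + value (m - d) ≤ value (q - d) + value m := by
  rcases hd.eq_or_lt with rfl | hd
  · simp
  have hpos : 0 < m - q + d := by linarith
  have hsum : (m - q) / (m - q + d) + d / (m - q + d) = 1 := by field_simp
  have h0 : 0 ≤ (m - q) / (m - q + d) := div_nonneg (by linarith) hpos.le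
  have h1 : 0 ≤ d / (m - q + d) := by positivity
  have hq := convexOn_value.2 (Set.mem_univ (q - d)) (Set.mem_univ m) h0 h1 hsum
  have hq' := convexOn_value.2 (Set.mem_univ (q - d)) (Set.mem_univ m) h1 h0
    (by rw [add_comm]; exact hsum)
  simp only [smul_eq_mul] at hq hq'
  rw [show (m - q) / (m - q + d) * (q - d) + d / (m - q + d) * m = q by field_simp; ring] at hq
  rw [show d / (m - q + d) * (q - d) + (m - q) / (m - q + d) * m = m - d by
    field_simp; ring] at hq'
  have e1 : (m - q) / (m - q + d) = 1 - d / (m - q + d) := by linarith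
  rw [e1] at hq hq'
  linarith

/-- Midpoint convexity; the half mile that a full stomach adds to the turning point cancels the
factor `1 / 2`. -/
theorem value_full_stomach (q r : ℝ) : value ((q + r + 1) / 2) ≤ value q + value r := by
  have h := convexOn_value.2 (Set.mem_univ q) (Set.mem_univ r)
    (show (0 : ℝ) ≤ 1 / 2 by norm_num) (show (0 : ℝ) ≤ 1 / 2 by norm_num) (by norm_num)
  simp only [smul_eq_mul] at h
  rw [show (q + r + 1) / 2 = (1 / 2 * q + 1 / 2 * r) + 1 / 2 by ring, value_add_half]
  linarith

/-- Convexity with weights `2 / 3` and `1 / 3`, after the second point is moved half a mile ahead.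
These weights make `d` cancel. -/
theorem value_two_bananas (a d : ℝ) :
    3 / 2 * value (a - 1 / 6) ≤ value (a - d) + value (a - 1 + 2 * d) := by
  have h := convexOn_value.2 (Set.mem_univ (a - d)) (Set.mem_univ (a - 1 + 2 * d + 1 / 2))
    (show (0 : ℝ) ≤ 2 / 3 by norm_num) (show (0 : ℝ) ≤ 1 / 3 by norm_num) (by norm_num)
  simp only [smul_eq_mul, value_add_half] at h
  rw [show 2 / 3 * (a - d) + 1 / 3 * (a - 1 + 2 * d + 1 / 2) = a - 1 / 6 by ring] at h
  linarith

theorem value_eq_of_floor {x : ℝ} {n : ℤ} (h0 : (n : ℝ) ≤ 2 * x) (h1 : 2 * x < n + 1) :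
    value x = 2 ^ n * (1 + (2 * x - n)) := by
  rw [value, p_two, Int.floor_eq_iff.2 ⟨h0, h1⟩]

theorem value_zero : value 0 = 1 := by
  rw [value_eq_of_floor (n := 0) (by norm_num) (by norm_num)]
  norm_num

theorem one_add_le_value (x : ℝ) : 1 + x ≤ value x := by
  rcases le_total 0 x with h | h
  · have := p_two_support 0 (2 * x)
    have h0 : p 2 0 = 1 := by simpa [value] using value_zero
    simp [h0] at this
    unfold value
    linarith
  · have h0 := value_pos x
    have h1 := p_two_support (-1) (2 * x)
    have h2 : p 2 (-1) = 1 / 2 := by norm_num [p_two]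
    rw [h2, show ⌊(-1 : ℝ)⌋ = -1 by norm_num] at h1
    norm_num at h1
    unfold value
    linarith

theorem one_add_two_mul_le_value (x : ℝ) : 1 + 2 * x ≤ value x := by
  have := p_two_support 0 (2 * x)
  have h0 : p 2 0 = 1 := by simpa [value] using value_zero
  simp [h0] at this
  exact this

/-- A partly filled stomach at the start is worth at most its contents. The turning point is less
than one mile out, so only two linear pieces of `value` occur. -/
theorem value_start {s r : ℝ} (hs : s < 1) (hr : |r| ≤ s) :
    value ((r + s) / 2) ≤ value r + s := by
  obtain ⟨h0, h1⟩ := abs_le.1 hr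
  have l1 := one_add_le_value r
  have l2 := one_add_two_mul_le_value r
  rcases lt_or_ge (r + s) 1 with h | h
  · rw [value_eq_of_floor (n := 0) (by push_cast; linarith) (by push_cast; linarith)]
    norm_num
    linarith
  · rw [value_eq_of_floor (n := 1) (by push_cast; linarith) (by push_cast; linarith)]
    norm_num
    linarith

/-! ### Discarding uneaten bananas. -/

/-- Bananas that are not eaten can be removed from the start. -/
theorem exists_eat_all {c : ℝ} {S t : State} (h : Relation.ReflTransGen Step S t)
    (ht : t.pos = c) : ∃ (b : Bool) (g : Multiset ℝ), (b = true → S.carrying = true) ∧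
      g ≤ S.ground ∧ ∃ s, Relation.ReflTransGen Step ⟨S.pos, S.stomach, b, g⟩ ⟨c, s, false, 0⟩ := by
  induction h using Relation.ReflTransGen.head_induction_on with
  | refl => exact ⟨false, 0, by simp, Multiset.zero_le _, t.stomach, by rw [ht]⟩
  | head hstep _ ih =>
    obtain ⟨b, g, hb, hg, s, hs⟩ := ih
    cases hstep with
    | walk x y s' b' g' h => exact ⟨b, g, hb, hg, s, .head (.walk _ _ _ _ _ h) hs⟩
    | pickUp x s' g' =>
      cases b with
      | true => exact ⟨false, x ::ₘ g, by simp, Multiset.cons_le_cons _ hg, s,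
          .head (.pickUp _ _ _) hs⟩
      | false => exact ⟨false, g, by simp, hg.trans (Multiset.le_cons_self _ _), s, hs⟩
    | putDown x s' g' =>
      have hb' : b = false := by simpa using hb
      subst hb'
      by_cases hx : g ≤ g'
      -- The banana put down is not needed later, so the camel need not have carried it.
      · exact ⟨false, g, by simp, hx, s, hs⟩
      · have hmem : x ∈ g := by
          by_contra hn
          exact hx ((Multiset.le_cons_of_notMem hn).1 hg)
        obtain ⟨g'', rfl⟩ := Multiset.exists_cons_of_mem hmem
        exact ⟨true, g'', by simp, (Multiset.cons_le_cons_iff _).1 hg, s,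
          .head (.putDown _ _ _) hs⟩
    | eatGround x b' g' =>
      exact ⟨b, x ::ₘ g, hb, Multiset.cons_le_cons _ hg, s, .head (.eatGround _ _ _) hs⟩
    | eatCarried x g' =>
      have hb' : b = false := by simpa using hb
      subst hb'
      exact ⟨true, g, by simp, hg, s, .head (.eatCarried _ _) hs⟩

/-- All bananas of a state, including the carried one. -/
def State.bananas (S : State) : Multiset ℝ :=
  if S.carrying then S.pos ::ₘ S.ground else S.ground

/-! ### The last two bananas. -/

/-- The walk that a camel at `q` needs to bring bananas at `u` and `v` to `a` or farther. -/
noncomputable def pairCost (a q u v : ℝ) : ℝ :=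
  -- Walk to the rear banana, bring it to `a`, then go back for the other one: the shorter distance
  -- is walked twice, the longer once.
  |max (a - q) 0 - max (max (a - u) 0) (max (a - v) 0)|
    + 2 * min (max (a - u) 0) (max (a - v) 0) + max (max (a - u) 0) (max (a - v) 0)

theorem pairCost_comm (a q u v : ℝ) : pairCost a q u v = pairCost a q v u := by
  simp only [pairCost, max_comm, min_comm]

theorem abs_posPart_sub_le (a x y : ℝ) : |max (a - x) 0 - max (a - y) 0| ≤ |y - x| := by
  have := abs_max_sub_max_le_abs (a - x) (a - y) 0
  rwa [show a - x - (a - y) = y - x by ring] at this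

theorem pairCost_self (a q v : ℝ) :
    pairCost a q q v = max (a - q) 0 + 2 * max (a - v) 0 := by
  unfold pairCost
  rcases le_total (max (a - q) 0) (max (a - v) 0) with h | h
  · rw [max_eq_right h, min_eq_left h, abs_of_nonpos (by linarith)]
    ring
  · rw [max_eq_left h, min_eq_right h, sub_self, abs_zero]
    ring

theorem pairCost_walk (a x y u v : ℝ) : pairCost a x u v ≤ pairCost a y u v + |y - x| := by
  have h := abs_posPart_sub_le a x y
  have := abs_sub_le (max (a - x) 0) (max (a - y) 0) (max (max (a - u) 0) (max (a - v) 0))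
  unfold pairCost
  linarith

theorem pairCost_walk_carrying (a x y v : ℝ) :
    pairCost a x x v ≤ pairCost a y y v + |y - x| := by
  rw [pairCost_self, pairCost_self]
  have := le_abs_self (max (a - x) 0 - max (a - y) 0)
  linarith [abs_posPart_sub_le a x y]

theorem value_pair {a q u v : ℝ} (h : pairCost a q u v ≤ 1) :
    3 / 2 * value (a - 1 / 6) ≤ value u + value v := by
  wlog huv : v ≤ u generalizing u v
  · rw [add_comm]
    exact this (by rwa [pairCost_comm]) (le_of_not_ge huv)
  have hle : max (a - u) 0 ≤ max (a - v) 0 := max_le_max_right _ (by linarith)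
  unfold pairCost at h
  rw [max_eq_right hle, min_eq_left hle] at h
  have h0 := abs_nonneg (max (a - q) 0 - max (a - v) 0)
  have h1 := le_max_left (a - u) 0
  have h2 := le_max_left (a - v) 0
  have h3 := value_two_bananas a (max (a - u) 0)
  have h4 := value_mono (show a - max (a - u) 0 ≤ u by linarith)
  have h5 := value_mono (show a - 1 + 2 * max (a - u) 0 ≤ v by linarith)
  linarith

/-! ### The backward invariant. -/

/-- A necessary condition for a camel with position `q` and stomach contents `s` to reach `c`,
eating all bananas of `A`. -/
def Feasible (c q s : ℝ) (A : Multiset ℝ) : Prop :=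
  (A = 0 ∧ c ≤ q + s) ∨
  (∃ f, A = {f} ∧ |q - f| ≤ s ∧ c ≤ f + s - |q - f| + 1) ∨
  (∃ u v, A = {u, v} ∧ pairCost (c - 2) q u v ≤ s) ∨
  -- Here `r` is the place of the next meal, and `(q + r + s) / 2` is the turning point on the way
  -- there.
  (3 ≤ A.card ∧ ∃ r, |r - q| ≤ s ∧ 3 / 2 * value (c - 13 / 6) ≤
    (A.map value).sum + value ((q + r + s) / 2) - value q - value r)

theorem value_walk {x y s r : ℝ} (hr : |r - y| ≤ s - |y - x|) :
    value ((y + r + (s - |y - x|)) / 2) - value y ≤ value ((x + r + s) / 2) - value x ∧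
    value ((y + r + (s - |y - x|)) / 2) ≤ value ((x + r + s) / 2) := by
  have hr' := (abs_le.1 hr)
  rcases le_total x y with h | h
  · rw [abs_of_nonneg (by linarith), show (y + r + (s - (y - x))) / 2 = (x + r + s) / 2 by ring]
    exact ⟨by linarith [value_mono h], le_rfl⟩
  · rw [abs_of_nonpos (by linarith)] at hr' ⊢
    -- Walking back moves the turning point back by the same distance, and the turning point lies
    -- ahead of the camel, so its loss of value is the larger one.
    have := value_add_le (q := x) (m := (x + r + s) / 2) (d := x - y) (by linarith) (by linarith)
    rw [show (y + r + (s - -(y - x))) / 2 = (x + r + s) / 2 - (x - y) by ring]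
    rw [sub_sub_cancel] at this
    exact ⟨by linarith, value_mono (by linarith)⟩

theorem abs_walk {x y s r : ℝ} (hr : |r - y| ≤ s - |y - x|) : |r - x| ≤ s := by
  linarith [abs_sub_le r y x]

theorem Feasible.walk {c x y s : ℝ} {A : Multiset ℝ} (h : Feasible c y (s - |y - x|) A) :
    Feasible c x s A := by
  rcases h with ⟨rfl, h⟩ | ⟨f, rfl, h1, h2⟩ | ⟨u, v, rfl, h⟩ | ⟨h3, r, hr, h⟩
  · exact .inl ⟨rfl, by linarith [le_abs_self (y - x)]⟩
  · have := abs_sub_le x y f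
    rw [abs_sub_comm x y] at this
    exact .inr (.inl ⟨f, rfl, by linarith, by linarith⟩)
  · exact .inr (.inr (.inl ⟨u, v, rfl, by linarith [pairCost_walk (c - 2) x y u v]⟩))
  · exact .inr (.inr (.inr ⟨h3, r, abs_walk hr, by linarith [(value_walk hr).1]⟩))

theorem Feasible.walk_carrying {c x y s : ℝ} {g : Multiset ℝ}
    (h : Feasible c y (s - |y - x|) (y ::ₘ g)) : Feasible c x s (x ::ₘ g) := by
  rcases h with ⟨h, -⟩ | ⟨f, hf, h1, h2⟩ | ⟨u, v, huv, h⟩ | ⟨h3, r, hr, h⟩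
  · simp at h
  · obtain rfl : y = f := Multiset.mem_singleton.1 (hf ▸ Multiset.mem_cons_self y g)
    obtain rfl : g = 0 := (Multiset.cons_inj_right y).1 hf
    have := abs_nonneg (y - x)
    rw [sub_self, abs_zero] at h1 h2
    exact .inr (.inl ⟨x, rfl, by simp; linarith, by
      simp; linarith [le_abs_self (y - x)]⟩)
  · have hy : y ∈ ({u, v} : Multiset ℝ) := huv ▸ Multiset.mem_cons_self y g
    wlog hyu : y = u generalizing u v
    · have hyv : y = v := by simpa [hyu] using hy
      rw [Multiset.pair_comm] at huv hy
      rw [pairCost_comm] at h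
      exact this v u huv h hy hyv
    subst hyu
    obtain rfl : g = {v} := (Multiset.cons_inj_right y).1 huv
    exact .inr (.inr (.inl ⟨x, v, rfl, by linarith [pairCost_walk_carrying (c - 2) x y v]⟩))
  · refine .inr (.inr (.inr ⟨by simpa using h3, r, abs_walk hr, ?_⟩))
    simp only [Multiset.map_cons, Multiset.sum_cons] at h ⊢
    -- The value of the carried banana cancels the term for the camel's position, so only the
    -- turning point matters.
    linarith [(value_walk hr).2]

theorem Feasible.eat {c q : ℝ} {A : Multiset ℝ} (h : Feasible c q 1 A) :
    Feasible c q 0 (q ::ₘ A) := by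
  rcases h with ⟨rfl, h⟩ | ⟨f, rfl, h1, h2⟩ | ⟨u, v, rfl, h⟩ | ⟨h3, r, hr, h⟩
  · exact .inr (.inl ⟨q, rfl, by simp, by simpa [add_comm] using h⟩)
  · refine .inr (.inr (.inl ⟨q, f, rfl, ?_⟩))
    have := abs_nonneg (q - f)
    have := le_abs_self (f - q)
    rw [abs_sub_comm] at this
    -- With a full stomach, `h2` forces both `q` and `f` to be at least `c - 2`, so no walk is
    -- needed.
    rw [pairCost_self, max_eq_right (by linarith), max_eq_right (by linarith)]
    simp
  · refine .inr (.inr (.inr ⟨by simp, q, by simp, ?_⟩))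
    have := value_pair h
    rw [show c - 2 - 1 / 6 = c - 13 / 6 by ring] at this
    simp only [Multiset.insert_eq_cons, Multiset.map_cons, Multiset.map_singleton,
      Multiset.sum_cons, Multiset.sum_singleton, add_zero, add_self_div_two]
    linarith
  -- On an empty stomach the next meal is here, so `r = q`; the stomach terms become `-value q` and
  -- cancel the value of the banana to be eaten.
  · refine .inr (.inr (.inr ⟨by simp; omega, q, by simp, ?_⟩))
    have := value_full_stomach q r
    simp only [Multiset.map_cons, Multiset.sum_cons, add_zero, add_self_div_two]
    linarith

theorem feasible_of_step {c : ℝ} {S T : State} (h : Step S T)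
    (hT : Feasible c T.pos T.stomach T.bananas) : Feasible c S.pos S.stomach S.bananas := by
  cases h with
  | walk x y s b g h =>
    cases b
    · exact Feasible.walk hT
    · exact Feasible.walk_carrying hT
  | pickUp x s g => exact hT
  | putDown x s g => exact hT
  | eatGround x b g =>
    cases b
    · exact Feasible.eat hT
    · have := Feasible.eat hT
      simpa [State.bananas, Multiset.cons_swap] using this
  | eatCarried x g => exact Feasible.eat hT

theorem feasible_of_reach {c s : ℝ} {S : State}
    (h : Relation.ReflTransGen Step S ⟨c, s, false, 0⟩) (hs : 0 ≤ s) :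
    Feasible c S.pos S.stomach S.bananas := by
  induction h using Relation.ReflTransGen.head_induction_on with
  | refl => exact .inl ⟨rfl, by simpa using hs⟩
  | head h _ ih => exact feasible_of_step h ih

theorem stomach_nonneg {S T : State} (h : Relation.ReflTransGen Step S T) (hS : 0 ≤ S.stomach) :
    0 ≤ T.stomach := by
  induction h with
  | refl => exact hS
  | tail _ h ih =>
    cases h with
    | walk x y s b g h => simpa using h
    | _ => first | exact ih | exact zero_le_one

theorem value_le_of_feasible {c s : ℝ} {k : ℕ} (hs : s < 1)
    (h : Feasible c 0 s (Multiset.replicate k 0)) {N : ℝ} (hN : 3 ≤ N) (hk : k + s ≤ N) :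
    3 / 2 * value (c - 13 / 6) ≤ N - 1 := by
  -- With at most two bananas eaten, `c` is at most `7 / 3`, since `3 * (c - 2) ≤ s < 1` in the case
  -- of two. There `3 / 2 * value (1 / 6) = 2 ≤ N - 1`; this is where `3 ≤ N` enters.
  have small : c ≤ 7 / 3 → 3 / 2 * value (c - 13 / 6) ≤ N - 1 := fun hc => by
    have h1 := value_mono (show c - 13 / 6 ≤ 1 / 6 by linarith)
    rw [value_eq_of_floor (x := 1 / 6) (n := 0) (by norm_num) (by norm_num)] at h1
    norm_num at h1
    linarith
  rcases h with ⟨-, h⟩ | ⟨f, hf, h1, h2⟩ | ⟨u, v, huv, h⟩ | ⟨h3, r, hr, h⟩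
  · exact small (by linarith)
  · have : f ∈ Multiset.replicate k (0 : ℝ) := by simp [hf]
    obtain rfl := Multiset.eq_of_mem_replicate this
    simp at h2
    exact small (by linarith)
  · have hu : u ∈ Multiset.replicate k (0 : ℝ) := by simp [huv]
    have hv : v ∈ Multiset.replicate k (0 : ℝ) := by simp [huv]
    obtain rfl := Multiset.eq_of_mem_replicate hu
    obtain rfl := Multiset.eq_of_mem_replicate hv
    rw [pairCost_self] at h
    exact small (by linarith [le_max_left (c - 2 - 0) 0])
  · have := value_start hs (r := r) (by simpa using hr)
    simp only [Multiset.map_replicate, Multiset.sum_replicate, value_zero, nsmul_eq_mul, mul_one,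
      zero_add] at h
    linarith

end CamelBanana

theorem mainTheorem8 (N : ℝ) (hN : 3 ≤ N) (c : ℝ) (hc : CamelBanana.CanPenetrate N c) :
    c ≤ 1 / 2 * CamelBanana.pInv 2 (2 / 3 * (N - 1)) + 13 / 6 := by
  obtain ⟨t, ht, htc⟩ := hc
  obtain ⟨b, g, hb, hg, s, hs⟩ := CamelBanana.exists_eat_all ht htc
  have hN0 : (0 : ℝ) ≤ N := by linarith
  have h0 := Nat.floor_le hN0
  have h1 := Nat.lt_floor_add_one N
  have hb' : b = false := by simpa [CamelBanana.start] using hb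
  subst hb'
  obtain ⟨k, hk, rfl⟩ := Multiset.le_replicate_iff.1 hg
  have hk' : (k : ℝ) ≤ ⌊N⌋₊ := by exact_mod_cast hk
  have hst : 0 ≤ s := CamelBanana.stomach_nonneg hs (by simp [CamelBanana.start]; exact h0)
  have hf := CamelBanana.feasible_of_reach hs hst
  have hv := CamelBanana.value_le_of_feasible (N := N) (k := k) (s := N - ⌊N⌋₊) (by linarith)
    hf hN (by linarith)
  have hp := CamelBanana.p_pInv one_le_two (show 0 < 2 / 3 * (N - 1) by linarith)
  have hle : CamelBanana.p 2 (2 * (c - 13 / 6))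
      ≤ CamelBanana.p 2 (CamelBanana.pInv 2 (2 / 3 * (N - 1))) := by
    rw [hp]
    unfold CamelBanana.value at hv
    linarith
  have := CamelBanana.p_two_strictMono.le_iff_le.1 hle
  linarith
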